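/- Let $p$ be an odd prime, let $|\cdot|_p$ be the absolute value of $\mathbb C_p$ with $|p|_p=1/p$, and let $q\in\mathbb C_p$ with $|1-q|_p<1$. Write $[n]_q=1+q+\cdots+q^{n-1}$ (so $[n]_q=\frac{1-q^n}{1-q}$ if $q\ne1$) and $[n]_{-q}=\frac{1-(-q)^n}{1+q}$. Let $\omega$ be the Teichmüller character mod $p$, and put $\langle a\rangle=a/\omega(a)$ for $p\nmid a$, $\langle a\rangle^{s}=\sum_{k\ge0}\binom sk(\langle a\rangle-1)^k$ and $\binom sk=\frac{s(s-1)\cdots(s-k+1)}{k!}$. The $q$-Euler numbers $E_{n,q}$ and, for a primitive $\mathbb C_p$-valued Dirichlet character $\psi$ of odd conductor $m$, the generalized $q$-Euler numbers $E_{n,\psi,q}$ are defined by $$\frac{[2]_q}{qe^t+1}=\sum_{n\ge0}E_{n,q}\frac{t^n}{n!},\qquad \frac{[2]_q\sum_{a=1}^{m}(-1)^aq^a\psi(a)e^{at}}{q^me^{mt}+1}=\sum_{n\ge0}E_{n,\psi,q}\frac{t^n}{n!}.$$ Let $\chi$ be a primitive $\mathbb C_p$-valued Dirichlet character of conductor $d$,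 let $F$ be an odd positive integer that is a multiple of both $p$ and $d$, and for $n\ge 1$ let $\chi_n$ be the primitive Dirichlet character attached to $\chi\omega^{-n}$. Let $X=\varprojlim_N\mathbb Z/dp^N\mathbb Z$, let $X^*=\bigcup_{0<a<dp,\,(a,p)=1}(a+dp\mathbb Z_p)\subset X$, and for $f\colon X\to\mathbb C_p$ let $$\int_Xf(x)\,d\mu_{-q}(x)=\lim_{N\to\infty}\frac1{[dp^N]_{-q}}\sum_{x=0}^{dp^N-1}f(x)(-q)^x,\qquad \int_{X^*}f\,d\mu_{-q}=\int_X f\cdot\mathbf 1_{X^*}\,d\mu_{-q},$$ whenever the limit exists. Define $$l_{p,q}(s,\chi)=\frac{[2]_q}{[2]_{q^F}}\sum_{\substack{1\le a\le F\\ p\nmid a}}(-1)^a\chi(a)q^a\langle a\rangle^{-s}\sum_{k=0}^\infty\binom{-s}k\Big(\frac Fa\Big)^kE_{k,q^F}.$$ Then: (a) For every $s\in D=\{s\in\mathbb C_p: |s|_p<p^{1-\frac1{p-1}}\}$ all the series in this definition converge, and $l_{p,q}(s,\chi)$ is analytic in $D$, that is, it is given on all of $D$ by one convergent power series in $s$.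 (b) For every integer $n\ge1$, $$l_{p,q}(-n,\chi)=E_{n,\chi_n,q}-p^n\chi_n(p)\frac{[2]_q}{[2]_{q^p}}E_{n,\chi_n,q^p}.$$ (c) For every integer $n\ge1$ the integral $\int_{X^*}\chi_n(x)x^n\,d\mu_{-q}(x)$ exists and $$l_{p,q}(-n,\chi)=\int_{X^*}\chi_n(x)x^n\,d\mu_{-q}(x).$$ -/

import Mathlib

open Filter Topology

noncomputable section

namespace QEuler

/-! ### `q`-numbers, binomial coefficients, `q`-Euler numbers -/

section Field

variable {K : Type*} [Field K]

/-- The `q`-number `[n]_q = 1 + q + ⋯ + q ^ (n - 1)`, which is `(1 - q ^ n) / (1 - q)` for `q ≠ 1`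
(see `qNumber_eq_div`) and is `n` for `q = 1`. The number `[n]_{-q}` is `qNumber (-q) n`. -/
def qNumber (q : K) (n : ℕ) : K := ∑ i ∈ Finset.range n, q ^ i

theorem qNumber_eq_div {q : K} (hq : q ≠ 1) (n : ℕ) :
    qNumber q n = (1 - q ^ n) / (1 - q) := by
  rw [qNumber, geom_sum_eq hq, ← neg_sub 1 (q ^ n), ← neg_sub 1 q, neg_div_neg_eq]

/-- The binomial coefficient `s (s - 1) ⋯ (s - k + 1) / k!` for an arbitrary element `s`. -/
def binom (s : K) (k : ℕ) : K := (∏ i ∈ Finset.range k, (s - i)) / (k.factorial : K)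

variable [CharZero K]

/-- The formal power series `e ^ (c t)`. -/
def expSeries (c : K) : PowerSeries K := PowerSeries.rescale c (PowerSeries.exp K)

/-- The `q`-Euler numbers `E_{n,q}`:
`[2]_q / (q e ^ t + 1) = ∑ E_{n,q} t ^ n / n!`. -/
def qEuler (q : K) (n : ℕ) : K :=
  (n.factorial : K) * PowerSeries.coeff n
    (PowerSeries.C (qNumber q 2) * (PowerSeries.C q * expSeries 1 + 1)⁻¹)

/-- The generalized `q`-Euler numbers `E_{n,ψ,q}` attached to a Dirichlet character `ψ` mod `m`
(to be used for primitive `ψ`, so that `m` is the conductor):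
`[2]_q (∑_{a=1}^m (-1)^a q^a ψ(a) e^(a t)) / (q^m e^(m t) + 1) = ∑ E_{n,ψ,q} t ^ n / n!`. -/
def qEulerChar {m : ℕ} (ψ : DirichletCharacter K m) (q : K) (n : ℕ) : K :=
  (n.factorial : K) * PowerSeries.coeff n
    (PowerSeries.C (qNumber q 2) *
      (∑ a ∈ Finset.Icc 1 m, PowerSeries.C ((-1) ^ a * q ^ a * ψ (a : ZMod m)) *
        expSeries (a : K)) *
      (PowerSeries.C (q ^ m) * expSeries (m : K) + 1)⁻¹)

end Field

variable (p : ℕ) [Fact p.Prime]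

/-! ### The Teichmüller character -/

/-- The Teichmüller character `ω` mod `p` with values in `ℂ_[p]`: the Teichmüller lift
`ZMod p → W(ZMod p) ≃ ℤ_[p]` followed by the inclusion `ℤ_[p] ⊆ ℚ_[p] ⊆ ℂ_[p]`. -/
def teich : DirichletCharacter ℂ_[p] p where
  toFun a := algebraMap ℚ_[p] ℂ_[p]
    ((WittVector.equiv p (WittVector.teichmuller p a) : ℤ_[p]) : ℚ_[p])
  map_one' := by simp
  map_mul' a b := by simp
  map_nonunit' a ha := by
    have h : a = 0 := by simpa [isUnit_iff_ne_zero] using ha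
    simp [h, WittVector.teichmuller_zero]

/-- `⟨a⟩ = a / ω(a)`. -/
def angle (a : ℕ) : ℂ_[p] := (a : ℂ_[p]) / teich p (a : ZMod p)

/-- The `p`-adic power `x ^ s = (1 + (x - 1)) ^ s` given by the binomial series. -/
def padicPow (x s : ℂ_[p]) : ℂ_[p] := ∑' k : ℕ, binom s k * (x - 1) ^ k

variable {p} in
/-- The primitive character `χ_n = χ ω⁻ⁿ` (its modulus is its conductor). -/
def twist {d : ℕ} (χ : DirichletCharacter ℂ_[p] d) (n : ℕ) :
    DirichletCharacter ℂ_[p] (χ.mul ((teich p)⁻¹ ^ n)).conductor :=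
  χ.primitive_mul ((teich p)⁻¹ ^ n)

variable {p} in
/-- The `p`-adic `l_q`-function
`[2]_q / [2]_{q^F} ∑_{1 ≤ a ≤ F, p ∤ a} (-1)^a χ(a) q^a ⟨a⟩^{-s} ∑_k binom(-s,k) (F/a)^k E_{k,q^F}`. -/
def lpq {d : ℕ} (χ : DirichletCharacter ℂ_[p] d) (q : ℂ_[p]) (F : ℕ) (s : ℂ_[p]) : ℂ_[p] :=
  qNumber q 2 / qNumber (q ^ F) 2 *
    ∑ a ∈ (Finset.Icc 1 F).filter (fun a => ¬ p ∣ a),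
      (-1) ^ a * χ (a : ZMod d) * q ^ a * padicPow p (angle p a) (-s) *
        ∑' k : ℕ, binom (-s) k * ((F : ℂ_[p]) / (a : ℂ_[p])) ^ k * qEuler (q ^ F) k

/-- The radius `p ^ (1 - 1 / (p - 1))`. -/
def radius : ℝ := (p : ℝ) ^ (1 - 1 / ((p : ℝ) - 1))

/-! ### The space `X` and the fermionic `q`-integral -/

/-- `X = X_d = lim_N ℤ / d p^N ℤ`, as a ring of compatible sequences. -/
def X (d : ℕ) : Subring (∀ N : ℕ, ZMod (d * p ^ N)) where
  carrier := {x | ∀ N : ℕ,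
    ZMod.castHom (mul_dvd_mul_left d (pow_dvd_pow p N.le_succ)) (ZMod (d * p ^ N)) (x (N + 1))
      = x N}
  zero_mem' N := by rw [Pi.zero_apply, map_zero, Pi.zero_apply]
  one_mem' N := by rw [Pi.one_apply, map_one, Pi.one_apply]
  add_mem' {x y} hx hy N := by rw [Pi.add_apply, map_add, hx N, hy N, Pi.add_apply]
  mul_mem' {x y} hx hy N := by rw [Pi.mul_apply, map_mul, hx N, hy N, Pi.mul_apply]
  neg_mem' {x} hx N := by rw [Pi.neg_apply, map_neg, hx N, Pi.neg_apply]

variable {p} {d : ℕ}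

/-- The projection `X → ℤ / d p^N ℤ`. -/
def X.proj (N : ℕ) : X p d →+* ZMod (d * p ^ N) :=
  (Pi.evalRingHom (fun N : ℕ => ZMod (d * p ^ N)) N).comp (X p d).subtype

theorem X.castHom_proj {M N : ℕ} (h : M ≤ N) (x : X p d) :
    ZMod.castHom (mul_dvd_mul_left d (pow_dvd_pow p h)) (ZMod (d * p ^ M)) (X.proj N x)
      = X.proj M x := by
  induction N, h using Nat.le_induction with
  | base => simp
  | succ N h ih =>
    have hx : ZMod.castHom (mul_dvd_mul_left d (pow_dvd_pow p N.le_succ)) (ZMod (d * p ^ N))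
      (X.proj (N + 1) x) = X.proj N x := x.2 N
    rw [← ih, ← hx]
    exact RingHom.congr_fun (Subsingleton.elim
      (ZMod.castHom (mul_dvd_mul_left d (pow_dvd_pow p (h.trans N.le_succ))) (ZMod (d * p ^ M)))
      ((ZMod.castHom (mul_dvd_mul_left d (pow_dvd_pow p h)) (ZMod (d * p ^ M))).comp
        (ZMod.castHom (mul_dvd_mul_left d (pow_dvd_pow p N.le_succ)) (ZMod (d * p ^ N))))) _

/-- The natural map `X → ℤ_[p]`. -/
def X.toPadicInt : X p d →+* ℤ_[p] :=
  PadicInt.lift (p := p)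
    (f := fun k => (ZMod.castHom (dvd_mul_left (p ^ k) d) (ZMod (p ^ k))).comp (X.proj k))
    (by
      intro k₁ k₂ hk
      ext x
      simp only [RingHom.comp_apply]
      rw [← X.castHom_proj hk x]
      exact RingHom.congr_fun (Subsingleton.elim
        ((ZMod.castHom (pow_dvd_pow p hk) (ZMod (p ^ k₁))).comp
          (ZMod.castHom (dvd_mul_left (p ^ k₂) d) (ZMod (p ^ k₂))))
        ((ZMod.castHom (dvd_mul_left (p ^ k₁) d) (ZMod (p ^ k₁))).comp
          (ZMod.castHom (mul_dvd_mul_left d (pow_dvd_pow p hk)) (ZMod (d * p ^ k₁))))) _)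

variable (p d) in
/-- `X^* = ⋃_{0 < a < dp, (a,p) = 1} (a + d p ℤ_p)`. -/
def Xstar : Set (X p d) :=
  {x | ∃ a : ℕ, 0 < a ∧ a < d * p ∧ a.Coprime p ∧ X.proj 1 x = (a : ZMod (d * p ^ 1))}

/-- The function `x ↦ ψ(x) x ^ n` on `X_d`, for a Dirichlet character `ψ` whose modulus `m`
divides `d p`; `ψ(x)` is then the value of `ψ` at the residue class of `x` mod `m`, and `x ^ n` is
formed in `ℤ_[p] ⊆ ℂ_[p]`. -/
def charMonomial {m : ℕ} (ψ : DirichletCharacter ℂ_[p] m) (n : ℕ) (x : X p d) : ℂ_[p] :=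
  ψ ((X.proj 1 x).cast : ZMod m) * algebraMap ℚ_[p] ℂ_[p] ((X.toPadicInt x : ℤ_[p]) : ℚ_[p]) ^ n

/-- `∫_X f dμ_{-q} = I`, that is,
`I = lim_N (1 / [d p^N]_{-q}) ∑_{0 ≤ x < d p^N} f(x) (-q)^x`
(the limit exists and is equal to `I`). -/
def HasFermionicIntegral (q : ℂ_[p]) (f : X p d → ℂ_[p]) (I : ℂ_[p]) : Prop :=
  Tendsto (fun N : ℕ => (1 / qNumber (-q) (d * p ^ N)) *
    ∑ x ∈ Finset.range (d * p ^ N), f (x : X p d) * (-q) ^ x) atTop (𝓝 I)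

/-- `∫_S f dμ_{-q} = I` for a subset `S` of `X`. -/
def HasFermionicIntegralOn (q : ℂ_[p]) (S : Set (X p d)) (f : X p d → ℂ_[p]) (I : ℂ_[p]) : Prop :=
  HasFermionicIntegral q (S.indicator f) I

end QEuler

end

open Filter Topology

noncomputable section

namespace QEuler

/-! ### Sums over residue classes -/

/-! Put $B=-qe^t$. For $g$ of odd period $M$ the quotient $\Phi_g=\sum_{a=1}^{M}g(a)B^a/(1-B^M)$
(`eulerQuot`) is formally $\sum_{a\ge1}g(a)B^a$, hence the same for every period
(`eulerQuot_eq_of_dvd`). With $g$ equal to $\chi_n$ off the multiples of $p$ and $0$ on them, all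
quantities in (b) and (c) equal $[2]_q\,n!\,[t^n]\Phi_g$.

At $s=-n$ the binomial series terminate and $\chi(a)\langle a\rangle^n=\chi_n(a)a^n$; the sum over
$k$ is then the convolution of $e^{at}$ with $1/(1-B^F)$ (`lpq_neg_natCast`). Splitting off the
indices $a=pb$ gives the Euler factor, since $t\mapsto pt$ carries $-q^pe^t$ to $B^p$
(`qNumber_mul_coeff_eulerQuot`). The Riemann sums of the integral are coefficients of
$\Phi_g(1-B^{dp^N})$ with prefactor $(1+q)/(1+q^{dp^N})$; as $B^{dp^N}\to-1$ coefficientwise, the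
two factors tend to $2$ and $[2]_q/2$ (`hasFermionicIntegralOn_Xstar_charMonomial`).

For (a), $\langle a\rangle-1$ and $F/a$ have norm at most $1/p$, $|E_{k,q^F}|\le1$, and $\binom sk$
is an integral polynomial in $s$ of degree $k$ divided by $k!$. Legendre's formula bounds $1/k!$,
and `isPowerSeriesOn_tsum_mul_eval` rearranges the sum into a power series. -/

theorem sum_Icc_one_eq_sum_range {R : Type*} [AddCommMonoid R] (f : ℕ → R) (M : ℕ) :
    ∑ a ∈ Finset.Icc 1 M, f a = ∑ a ∈ Finset.range M, f (a + 1) := by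
  induction M with
  | zero => simp
  | succ M ih => rw [Finset.sum_Icc_succ_top (by omega), ih, Finset.sum_range_succ]

theorem sum_Icc_filter_dvd {R : Type*} [AddCommMonoid R] (f : ℕ → R) {p : ℕ} (hp : 0 < p)
    (M : ℕ) :
    ∑ a ∈ (Finset.Icc 1 (p * M)).filter (fun a => p ∣ a), f a =
      ∑ b ∈ Finset.Icc 1 M, f (p * b) := by
  refine (Finset.sum_nbij' (fun b => p * b) (fun a => a / p) ?_ ?_ ?_ ?_ ?_).symm
  · intro b hb
    simp only [Finset.mem_Icc, Finset.mem_filter] at hb ⊢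
    exact ⟨⟨Nat.mul_pos hp hb.1, Nat.mul_le_mul_left p hb.2⟩, dvd_mul_right p b⟩
  · intro a ha
    simp only [Finset.mem_Icc, Finset.mem_filter] at ha ⊢
    obtain ⟨⟨h1, h2⟩, c, rfl⟩ := ha
    rw [Nat.mul_div_cancel_left c hp]
    exact ⟨Nat.pos_of_mul_pos_left h1, Nat.le_of_mul_le_mul_left h2 hp⟩
  · intro b _
    exact Nat.mul_div_cancel_left b hp
  · intro a ha
    exact Nat.mul_div_cancel' (Finset.mem_filter.1 ha).2
  · intro b _
    rfl

/-- The sum over $r$ periods is the sum over one period times $1+z^m+\cdots+z^{m(r-1)}$. The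
division-free form applies in a power series ring. -/
theorem sum_periodic_mul_pow {R : Type*} [CommRing R] (G : ℕ → R) (z : R) (m : ℕ)
    (hG : ∀ a, G (a + m) = G a) (r : ℕ) :
    (∑ a ∈ Finset.Icc 1 (m * r), G a * z ^ a) * (1 - z ^ m) =
      (∑ a ∈ Finset.Icc 1 m, G a * z ^ a) * (1 - z ^ (m * r)) := by
  have hG' : ∀ r a, G (m * r + a) = G a := by
    intro r
    induction r with
    | zero => simp
    | succ r ih =>
      intro a
      rw [show m * (r + 1) + a = m * r + (a + m) by ring, ih, hG]
  rw [sum_Icc_one_eq_sum_range, sum_Icc_one_eq_sum_range]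
  induction r with
  | zero => simp
  | succ r ih =>
    have h : ∑ a ∈ Finset.range m, G (m * r + a + 1) * z ^ (m * r + a + 1) =
        z ^ (m * r) * ∑ a ∈ Finset.range m, G (a + 1) * z ^ (a + 1) := by
      rw [Finset.mul_sum]
      refine Finset.sum_congr rfl fun a _ => ?_
      rw [add_assoc, hG', pow_add]
      ring
    rw [Nat.mul_succ, Finset.sum_range_add, h, add_mul, ih, pow_add]
    ring

/-! ### Exponential generating series -/

section Field

variable {K : Type*} [Field K]

theorem rescale_C (a c : K) :
    PowerSeries.rescale a (PowerSeries.C c) = PowerSeries.C c := by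
  ext n
  rw [PowerSeries.coeff_rescale, PowerSeries.coeff_C]
  split_ifs with h <;> simp [h]

theorem rescale_inv (a : K) (f : PowerSeries K) (hf : PowerSeries.constantCoeff f ≠ 0) :
    PowerSeries.rescale a f⁻¹ = (PowerSeries.rescale a f)⁻¹ := by
  have h : PowerSeries.constantCoeff (PowerSeries.rescale a f) ≠ 0 := by
    rwa [← PowerSeries.coeff_zero_eq_constantCoeff_apply, PowerSeries.coeff_rescale, pow_zero,
      one_mul, PowerSeries.coeff_zero_eq_constantCoeff_apply]
  rw [PowerSeries.eq_inv_iff_mul_eq_one h, ← map_mul, PowerSeries.inv_mul_cancel _ hf, map_one]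

variable [CharZero K]

theorem coeff_expSeries (c : K) (n : ℕ) :
    PowerSeries.coeff n (expSeries c) = c ^ n / n.factorial := by
  rw [expSeries, PowerSeries.coeff_rescale, PowerSeries.coeff_exp]
  simp [div_eq_mul_inv]

theorem rescale_expSeries (a c : K) :
    PowerSeries.rescale a (expSeries c) = expSeries (a * c) := by
  ext n
  rw [PowerSeries.coeff_rescale, coeff_expSeries, coeff_expSeries, mul_pow, mul_div_assoc]

/-- The series `-q e ^ t`. -/
def eulerBase (q : K) : PowerSeries K := PowerSeries.C (-q) * expSeries 1

theorem eulerBase_pow (q : K) (a : ℕ) :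
    eulerBase q ^ a = PowerSeries.C ((-q) ^ a) * expSeries (a : K) := by
  rw [eulerBase, mul_pow, ← map_pow]
  congr 1
  simp only [expSeries, PowerSeries.rescale_one, RingHom.id_apply]
  exact PowerSeries.exp_pow_eq_rescale_exp a

theorem coeff_eulerBase_pow (q : K) (a n : ℕ) :
    PowerSeries.coeff n (eulerBase q ^ a) = (-q) ^ a * ((a : K) ^ n / n.factorial) := by
  rw [eulerBase_pow, PowerSeries.coeff_C_mul, coeff_expSeries]

/-- Oddness of $p$ keeps the sign. This identity is the source of both $p^n$ and $q^p$ in the Euler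
factor. -/
theorem rescale_eulerBase (q : K) {p : ℕ} (hp : Odd p) :
    PowerSeries.rescale (p : K) (eulerBase (q ^ p)) = eulerBase q ^ p := by
  rw [eulerBase_pow, eulerBase, map_mul, rescale_C, rescale_expSeries, mul_one, hp.neg_pow]

theorem constantCoeff_one_sub_eulerBase_pow (q : K) (M : ℕ) :
    PowerSeries.constantCoeff (1 - eulerBase q ^ M) = 1 - (-q) ^ M := by
  rw [← PowerSeries.coeff_zero_eq_constantCoeff_apply, map_sub, coeff_eulerBase_pow]
  simp

/-- The generating series `∑_{a=1}^M g(a) (-q)^a e^(a t)`. -/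
def expSum (g : ℕ → K) (q : K) (M : ℕ) : PowerSeries K :=
  ∑ a ∈ Finset.Icc 1 M, PowerSeries.C (g a) * eulerBase q ^ a

theorem factorial_mul_coeff_expSum (g : ℕ → K) (q : K) (M n : ℕ) :
    (n.factorial : K) * PowerSeries.coeff n (expSum g q M) =
      ∑ a ∈ Finset.Icc 1 M, g a * (a : K) ^ n * (-q) ^ a := by
  have hn : (n.factorial : K) ≠ 0 := Nat.cast_ne_zero.2 n.factorial_ne_zero
  rw [expSum, map_sum, Finset.mul_sum]
  refine Finset.sum_congr rfl fun a _ => ?_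
  rw [PowerSeries.coeff_C_mul, coeff_eulerBase_pow]
  field_simp

/-- The quotient of `∑_{a=1}^M g(a) (-q)^a e^(a t)` by `1 - (-q)^M e^(M t)`. -/
def eulerQuot (g : ℕ → K) (q : K) (M : ℕ) : PowerSeries K :=
  expSum g q M * (1 - eulerBase q ^ M)⁻¹

theorem expSum_eq_eulerQuot_mul (g : ℕ → K) {q : K} {M : ℕ} (hM : 1 - (-q) ^ M ≠ 0) :
    expSum g q M = eulerQuot g q M * (1 - eulerBase q ^ M) := by
  rw [eulerQuot, mul_assoc, PowerSeries.inv_mul_cancel, mul_one]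
  rwa [constantCoeff_one_sub_eulerBase_pow]

/-- Makes the periods $F$, the conductor, $\operatorname{lcm}(d,p)$ and $dp^N$ interchangeable. -/
theorem eulerQuot_eq_of_dvd {g : ℕ → K} {q : K} {m M : ℕ} (hg : ∀ a, g (a + m) = g a)
    (hmM : m ∣ M) (hm : 1 - (-q) ^ m ≠ 0) (hM : 1 - (-q) ^ M ≠ 0) :
    eulerQuot g q M = eulerQuot g q m := by
  obtain ⟨r, rfl⟩ := hmM
  rw [← constantCoeff_one_sub_eulerBase_pow] at hm hM
  have h := sum_periodic_mul_pow (fun a => PowerSeries.C (g a)) (eulerBase q) m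
    (fun a => by rw [hg]) r
  change expSum g q (m * r) * _ = expSum g q m * _ at h
  have h1 := PowerSeries.mul_inv_cancel _ hm
  have h2 := PowerSeries.mul_inv_cancel _ hM
  rw [eulerQuot, eulerQuot]
  linear_combination (1 - eulerBase q ^ m)⁻¹ * (1 - eulerBase q ^ (m * r))⁻¹ * h
    - expSum g q (m * r) * (1 - eulerBase q ^ (m * r))⁻¹ * h1
    + expSum g q m * (1 - eulerBase q ^ m)⁻¹ * h2

/-- Splitting off the terms whose index is divisible by `p`. -/
theorem expSum_mul_eq_add (g : ℕ → K) (q : K) {p : ℕ} (hp : Odd p) (M : ℕ) :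
    expSum g q (p * M) = expSum (fun a => if p ∣ a then 0 else g a) q (p * M) +
      PowerSeries.rescale (p : K) (expSum (fun b => g (p * b)) (q ^ p) M) := by
  have h2 : PowerSeries.rescale (p : K) (expSum (fun b => g (p * b)) (q ^ p) M) =
      ∑ a ∈ (Finset.Icc 1 (p * M)).filter (fun a => p ∣ a),
        PowerSeries.C (g a) * eulerBase q ^ a := by
    rw [sum_Icc_filter_dvd _ hp.pos, expSum, map_sum]
    refine Finset.sum_congr rfl fun b _ => ?_
    rw [map_mul, rescale_C, map_pow, rescale_eulerBase q hp, pow_mul]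
  rw [h2, expSum, expSum, Finset.sum_filter, ← Finset.sum_add_distrib]
  refine Finset.sum_congr rfl fun a _ => ?_
  split_ifs <;> simp

theorem eulerQuot_mul_eq_add (g : ℕ → K) (q : K) {p : ℕ} (hp : Odd p) (M : ℕ)
    (hM : 1 - (-(q ^ p)) ^ M ≠ 0) :
    eulerQuot g q (p * M) = eulerQuot (fun a => if p ∣ a then 0 else g a) q (p * M) +
      PowerSeries.rescale (p : K) (eulerQuot (fun b => g (p * b)) (q ^ p) M) := by
  rw [← constantCoeff_one_sub_eulerBase_pow] at hM
  rw [eulerQuot, expSum_mul_eq_add g q hp, add_mul, eulerQuot, eulerQuot, map_mul,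
    rescale_inv _ _ hM, map_sub, map_one, map_pow, rescale_eulerBase q hp, pow_mul]

theorem eulerQuot_const_mul (c : K) (g : ℕ → K) (q : K) (M : ℕ) :
    eulerQuot (fun a => c * g a) q M = PowerSeries.C c * eulerQuot g q M := by
  simp only [eulerQuot, expSum, Finset.sum_mul, Finset.mul_sum, map_mul, mul_assoc]

theorem qEulerChar_eq {m : ℕ} (hm : Odd m) (ψ : DirichletCharacter K m) (q : K) (n : ℕ) :
    qEulerChar ψ q n = qNumber q 2 * ((n.factorial : K) *
      PowerSeries.coeff n (eulerQuot (fun a => ψ (a : ZMod m)) q m)) := by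
  rw [qEulerChar, mul_assoc, PowerSeries.coeff_C_mul, eulerQuot, expSum, eulerBase_pow q m,
    hm.neg_pow, map_neg, neg_mul, sub_neg_eq_add, add_comm 1]
  have : ∀ a : ℕ, PowerSeries.C (ψ (a : ZMod m)) * eulerBase q ^ a =
      PowerSeries.C ((-1) ^ a * q ^ a * ψ (a : ZMod m)) * expSeries (a : K) := by
    intro a
    rw [eulerBase_pow, ← mul_assoc, ← map_mul, neg_pow q a]
    ring_nf
  simp only [this]
  ring

/-- The multiplication-by-`F` form of the generating function of the `q ^ F`-Euler numbers. -/
theorem pow_mul_qEuler {F : ℕ} (hF : Odd F) {q : K} (hq : 1 - (-q) ^ F ≠ 0) (k : ℕ) :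
    (F : K) ^ k * qEuler (q ^ F) k = qNumber (q ^ F) 2 * ((k.factorial : K) *
      PowerSeries.coeff k (1 - eulerBase q ^ F)⁻¹) := by
  have h1 : PowerSeries.C (q ^ F) * expSeries 1 + 1 = 1 - eulerBase (q ^ F) := by
    rw [eulerBase, map_neg]
    ring
  have h2 : PowerSeries.constantCoeff (1 - eulerBase (q ^ F)) ≠ 0 := by
    have := constantCoeff_one_sub_eulerBase_pow (q ^ F) 1
    rw [pow_one, pow_one] at this
    rwa [this, ← hF.neg_pow]
  rw [qEuler, h1, PowerSeries.coeff_C_mul, ← rescale_eulerBase q hF,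
    show 1 - PowerSeries.rescale (F : K) (eulerBase (q ^ F)) =
      PowerSeries.rescale (F : K) (1 - eulerBase (q ^ F)) by rw [map_sub, map_one],
    ← rescale_inv _ _ h2, PowerSeries.coeff_rescale]
  ring

/-- Umbrally the left side is $(a+FE)^n$, whose generating function is $e^{at}$ times that of
$F^kE_{k,q^F}$. -/
theorem sum_choose_mul_qEuler {F : ℕ} (hF : Odd F) {q : K} (hq : 1 - (-q) ^ F ≠ 0) {a : ℕ}
    (ha : a ≠ 0) (n : ℕ) :
    (a : K) ^ n * ∑ k ∈ Finset.range (n + 1),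
        (n.choose k : K) * ((F : K) / (a : K)) ^ k * qEuler (q ^ F) k =
      qNumber (q ^ F) 2 * ((n.factorial : K) *
        PowerSeries.coeff n (expSeries (a : K) * (1 - eulerBase q ^ F)⁻¹)) := by
  have ha' : (a : K) ≠ 0 := Nat.cast_ne_zero.2 ha
  rw [PowerSeries.coeff_mul, Finset.Nat.sum_antidiagonal_eq_sum_range_succ_mk, Finset.mul_sum,
    Finset.mul_sum, Finset.mul_sum, ← Finset.sum_range_reflect]
  refine Finset.sum_congr rfl fun j hj => ?_
  have hj : j ≤ n := Nat.lt_succ_iff.1 (Finset.mem_range.1 hj)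
  rw [show n + 1 - 1 - j = n - j by omega]
  obtain ⟨k, rfl⟩ := Nat.exists_eq_add_of_le hj
  rw [Nat.add_sub_cancel_left, coeff_expSeries]
  have h := pow_mul_qEuler hF hq k
  have hc : ((j + k).choose k : K) * (k.factorial * j.factorial) = (j + k).factorial := by
    have := Nat.add_choose_mul_factorial_mul_factorial j k
    rw [← this, ← Nat.choose_symm_add]
    push_cast
    ring
  have hjf : (j.factorial : K) ≠ 0 := Nat.cast_ne_zero.2 j.factorial_ne_zero
  rw [← hc, div_pow, pow_add]
  field_simp
  linear_combination ((j + k).choose k : K) * h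

end Field

/-! ### Power series converging absolutely on a disk -/

section PowerSeriesOn

variable {K : Type*} [NontriviallyNormedField K]

/-- `f` is given on the disk `‖s‖ < r` by a power series that converges absolutely there. -/
def IsPowerSeriesOn (r : ℝ) (f : K → K) : Prop :=
  ∃ A : ℕ → K, (∀ t, 0 ≤ t → t < r → Summable fun j => ‖A j‖ * t ^ j) ∧
    ∀ s, ‖s‖ < r → HasSum (fun j => A j * s ^ j) (f s)

theorem IsPowerSeriesOn.congr {r : ℝ} {f g : K → K} (hf : IsPowerSeriesOn r f)
    (h : ∀ s, ‖s‖ < r → f s = g s) : IsPowerSeriesOn r g := by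
  obtain ⟨A, h1, h2⟩ := hf
  exact ⟨A, h1, fun s hs => h s hs ▸ h2 s hs⟩

theorem isPowerSeriesOn_const (r : ℝ) (c : K) : IsPowerSeriesOn r (fun _ => c) := by
  refine ⟨fun j => if j = 0 then c else 0, fun t _ _ => ?_, fun s _ => ?_⟩
  · refine summable_of_ne_finset_zero (s := {0}) fun j hj => ?_
    simp [Finset.mem_singleton.not.1 hj]
  · convert hasSum_single 0 fun j hj => ?_ using 1
    · simp
    · simp [hj]

theorem IsPowerSeriesOn.add {r : ℝ} {f g : K → K} (hf : IsPowerSeriesOn r f)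
    (hg : IsPowerSeriesOn r g) : IsPowerSeriesOn r (fun s => f s + g s) := by
  obtain ⟨A, hA, hA'⟩ := hf
  obtain ⟨B, hB, hB'⟩ := hg
  refine ⟨fun j => A j + B j, fun t h0 ht => ?_, fun s hs => ?_⟩
  · refine Summable.of_nonneg_of_le (fun j => by positivity) (fun j => ?_)
      ((hA t h0 ht).add (hB t h0 ht))
    rw [← add_mul]
    gcongr
    exact norm_add_le _ _
  · simpa only [add_mul] using (hA' s hs).add (hB' s hs)

theorem IsPowerSeriesOn.sum {ι : Type*} {r : ℝ} {f : ι → K → K} (S : Finset ι)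
    (hf : ∀ i ∈ S, IsPowerSeriesOn r (f i)) : IsPowerSeriesOn r (fun s => ∑ i ∈ S, f i s) := by
  classical
  induction S using Finset.induction_on with
  | empty => simpa using isPowerSeriesOn_const r (0 : K)
  | insert i S hi ih =>
    simp only [Finset.sum_insert hi]
    exact (hf i (Finset.mem_insert_self i S)).add
      (ih fun j hj => hf j (Finset.mem_insert_of_mem hj))

theorem IsPowerSeriesOn.comp_neg {r : ℝ} {f : K → K} (hf : IsPowerSeriesOn r f) :
    IsPowerSeriesOn r (fun s => f (-s)) := by
  obtain ⟨A, hA, hA'⟩ := hf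
  refine ⟨fun j => A j * (-1) ^ j, fun t h0 ht => by simpa using hA t h0 ht, fun s hs => ?_⟩
  refine (hA' (-s) (by rwa [norm_neg])).congr_fun fun j => ?_
  rw [neg_pow s]
  ring

theorem IsPowerSeriesOn.hasFPowerSeriesOnBall {r : ℝ} (hr : 0 < r) {f : K → K}
    (hf : IsPowerSeriesOn r f) :
    ∃ P : FormalMultilinearSeries K K K, HasFPowerSeriesOnBall f P 0 (ENNReal.ofReal r) := by
  obtain ⟨A, hA, hA'⟩ := hf
  refine ⟨FormalMultilinearSeries.ofScalars K A, ?_, ENNReal.ofReal_pos.2 hr, ?_⟩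
  · refine ENNReal.le_of_forall_nnreal_lt fun t ht => ?_
    refine FormalMultilinearSeries.le_radius_of_summable_norm _ ?_
    have ht' : (t : ℝ) < r := by
      rwa [← ENNReal.ofReal_coe_nnreal, ENNReal.ofReal_lt_ofReal_iff hr] at ht
    simpa only [FormalMultilinearSeries.ofScalars_norm] using hA t t.2 ht'
  · intro s hs
    have hs' : ‖s‖ < r := by
      rw [Metric.eball_ofReal, mem_ball_zero_iff] at hs
      exact hs
    rw [zero_add]
    simpa only [FormalMultilinearSeries.ofScalars_apply_eq, smul_eq_mul] using hA' s hs'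

variable [CompleteSpace K]

/-- Cauchy product; this is where the absolute convergence built into `IsPowerSeriesOn` is used. -/
theorem IsPowerSeriesOn.mul {r : ℝ} {f g : K → K} (hf : IsPowerSeriesOn r f)
    (hg : IsPowerSeriesOn r g) : IsPowerSeriesOn r (fun s => f s * g s) := by
  obtain ⟨A, hA, hA'⟩ := hf
  obtain ⟨B, hB, hB'⟩ := hg
  refine ⟨fun n => ∑ ij ∈ Finset.HasAntidiagonal.antidiagonal n, A ij.1 * B ij.2,
    fun t h0 ht => ?_, fun s hs => ?_⟩
  · have h := summable_norm_sum_mul_antidiagonal_of_summable_norm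
      (hA t h0 ht).norm (hB t h0 ht).norm
    refine Summable.of_nonneg_of_le (fun j => by positivity) (fun j => ?_) h
    refine le_trans ?_ (le_abs_self _)
    calc _ ≤ (∑ ij ∈ Finset.HasAntidiagonal.antidiagonal j, ‖A ij.1 * B ij.2‖) * t ^ j := by
            gcongr; exact norm_sum_le _ _
      _ = _ := by
        rw [Finset.sum_mul]
        refine Finset.sum_congr rfl fun ij hij => ?_
        rw [← Finset.HasAntidiagonal.mem_antidiagonal.1 hij, norm_mul, pow_add]
        ring
  · have h1 : Summable fun j => ‖A j * s ^ j‖ := by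
      simpa only [norm_mul, norm_pow] using hA ‖s‖ (norm_nonneg s) hs
    have h2 : Summable fun j => ‖B j * s ^ j‖ := by
      simpa only [norm_mul, norm_pow] using hB ‖s‖ (norm_nonneg s) hs
    beta_reduce
    rw [← (hA' s hs).tsum_eq, ← (hB' s hs).tsum_eq,
      tsum_mul_tsum_eq_tsum_sum_antidiagonal_of_summable_norm h1 h2]
    have h3 := (summable_norm_sum_mul_antidiagonal_of_summable_norm h1 h2).of_norm.hasSum
    refine h3.congr_fun fun n => ?_
    rw [Finset.sum_mul]
    refine Finset.sum_congr rfl fun ij hij => ?_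
    rw [← Finset.HasAntidiagonal.mem_antidiagonal.1 hij, pow_add]
    ring

/-- Rearrangement of `∑_k c_k Q_k(s)` into a power series, when `deg Q_k ≤ k`, the coefficients of
`Q_k` have norm at most `1` and `‖c_k‖ ≤ r ^ (-k)` with `r > 1`. -/
theorem isPowerSeriesOn_tsum_mul_eval {r : ℝ} (hr : 1 < r) (c : ℕ → K)
    (hc : ∀ k, ‖c k‖ ≤ r⁻¹ ^ k) (Q : ℕ → Polynomial K) (hQ : ∀ k, (Q k).natDegree ≤ k)
    (hQ' : ∀ k j, ‖(Q k).coeff j‖ ≤ 1) :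
    (∀ s, ‖s‖ < r → Summable fun k => c k * (Q k).eval s) ∧
      IsPowerSeriesOn r (fun s => ∑' k, c k * (Q k).eval s) := by
  have hr0 : 0 < r := one_pos.trans hr
  have hρ0 : 0 ≤ r⁻¹ := inv_nonneg.2 hr0.le
  have hρ1 : r⁻¹ < 1 := inv_lt_one_of_one_lt₀ hr
  have hgeom : Summable fun i : ℕ => r⁻¹ ^ i := summable_geometric_of_lt_one hρ0 hρ1
  -- Index by $i=k-j\ge0$, possible since $\deg Q_k\le k$. The bound $r^{-k}$ then splits as
  -- $r^{-i}r^{-j}$, and the factor $r^{-j}$ absorbs $s^j$.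
  let w : ℕ → ℕ → K := fun i j => c (i + j) * (Q (i + j)).coeff j
  have hw : ∀ i j, ‖w i j‖ ≤ r⁻¹ ^ i * r⁻¹ ^ j := fun i j => by
    rw [norm_mul, ← pow_add]
    exact (mul_le_of_le_one_right (norm_nonneg _) (hQ' _ _)).trans (hc _)
  have hwi : ∀ j, Summable fun i => ‖w i j‖ := fun j =>
    Summable.of_nonneg_of_le (fun _ => norm_nonneg _) (fun i => hw i j) (hgeom.mul_right _)
  have hA : ∀ j, ‖∑' i, w i j‖ ≤ (∑' i : ℕ, r⁻¹ ^ i) * r⁻¹ ^ j := fun j => by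
    refine (norm_tsum_le_tsum_norm (hwi j)).trans ?_
    rw [← tsum_mul_right]
    exact (hwi j).tsum_le_tsum (fun i => hw i j) (hgeom.mul_right _)
  have hratio : ∀ t, 0 ≤ t → t < r → Summable fun j : ℕ => (r⁻¹ * t) ^ j := fun t h0 ht => by
    refine summable_geometric_of_lt_one (by positivity) ?_
    rw [inv_mul_lt_iff₀ hr0]
    simpa using ht
  have hdouble : ∀ s, ‖s‖ < r → Summable fun x : ℕ × ℕ => w x.1 x.2 * s ^ x.2 := fun s hs => by
    refine Summable.of_norm_bounded
      (hgeom.mul_of_nonneg (hratio ‖s‖ (norm_nonneg s) hs) (fun i => by positivity)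
        (fun i => by positivity)) fun x => ?_
    rw [norm_mul, norm_pow, mul_pow, ← mul_assoc]
    gcongr
    exact hw _ _
  have hdiag : ∀ s, ‖s‖ < r → HasSum (fun k => c k * (Q k).eval s)
      (∑' x : ℕ × ℕ, w x.1 x.2 * s ^ x.2) := fun s hs => by
    -- Summation along the antidiagonals $i+j=k$ recovers $\sum_k c_kQ_k(s)$.
    have h := (Finset.HasAntidiagonal.sigmaAntidiagonalEquivProd (A := ℕ)).hasSum_iff.2
      (hdouble s hs).hasSum
    refine h.sigma fun k => ?_
    suffices hk : c k * (Q k).eval s = ∑ x : Finset.HasAntidiagonal.antidiagonal k,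
        w x.1.1 x.1.2 * s ^ x.1.2 by
      rw [hk]
      exact hasSum_fintype _
    rw [Polynomial.eval_eq_sum_range' (Nat.lt_succ_of_le (hQ k)), Finset.mul_sum]
    rw [Finset.sum_coe_sort (Finset.HasAntidiagonal.antidiagonal k)
        (fun x : ℕ × ℕ => w x.1 x.2 * s ^ x.2),
      Finset.Nat.sum_antidiagonal_eq_sum_range_succ_mk, ← Finset.sum_range_reflect]
    refine Finset.sum_congr rfl fun j hj => ?_
    have hj : j ≤ k := Nat.lt_succ_iff.1 (Finset.mem_range.1 hj)
    simp only [w]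
    rw [show k + 1 - 1 - j = k - j by omega, Nat.add_sub_cancel' hj, mul_assoc]
  refine ⟨fun s hs => (hdiag s hs).summable, fun j => ∑' i, w i j, fun t h0 ht => ?_,
    fun s hs => ?_⟩
  · refine Summable.of_nonneg_of_le (fun j => by positivity) (fun j => ?_)
      ((hratio t h0 ht).mul_left (∑' i : ℕ, r⁻¹ ^ i))
    rw [mul_pow, ← mul_assoc]
    gcongr
    exact hA j
  · beta_reduce
    rw [(hdiag s hs).tsum_eq]
    -- Summation over $i$ for fixed $j$ gives the power series in $s$.
    have h := (Equiv.prodComm ℕ ℕ).hasSum_iff.2 (hdouble s hs).hasSum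
    exact h.prod_fiberwise fun j => ((hwi j).of_norm.hasSum.mul_right (s ^ j))

end PowerSeriesOn

/-! ### Norm estimates in `ℂ_[p]` -/

section Norms

variable (p : ℕ) [Fact p.Prime]

theorem norm_algebraMap_padic (x : ℚ_[p]) : ‖algebraMap ℚ_[p] ℂ_[p] x‖ = ‖x‖ :=
  norm_algebraMap' ℂ_[p] x

theorem norm_natCast_padicComplex (n : ℕ) : ‖(n : ℂ_[p])‖ = ‖(n : ℚ_[p])‖ := by
  rw [← norm_algebraMap_padic, map_natCast]

theorem norm_prime_padicComplex : ‖(p : ℂ_[p])‖ = (p : ℝ)⁻¹ := by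
  rw [norm_natCast_padicComplex, Padic.norm_p]

theorem one_lt_radius (hp : p ≠ 2) : 1 < radius p := by
  have h3 : 2 < p := lt_of_le_of_ne (Fact.out : p.Prime).two_le (Ne.symm hp)
  have h3' : (2 : ℝ) < p := by exact_mod_cast h3
  refine Real.one_lt_rpow (by linarith) ?_
  rw [sub_pos, div_lt_one (by linarith)]
  linarith

/-- Legendre: $(p-1)v_p(k!)$ is $k$ minus the base-$p$ digit sum of $k$. -/
theorem norm_inv_factorial_le (k : ℕ) :
    ‖((k.factorial : ℂ_[p]))⁻¹‖ ≤ ((p : ℝ) ^ (1 / ((p : ℝ) - 1))) ^ k := by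
  have hp1 : 1 < p := (Fact.out : p.Prime).one_lt
  have hp1' : (1 : ℝ) < p := by exact_mod_cast hp1
  have h0 : (k.factorial : ℚ_[p]) ≠ 0 := Nat.cast_ne_zero.2 k.factorial_ne_zero
  rw [norm_inv, norm_natCast_padicComplex, Padic.norm_eq_zpow_neg_valuation h0,
    Padic.valuation_natCast, ← zpow_neg, neg_neg, zpow_natCast, ← Real.rpow_natCast,
    ← Real.rpow_natCast, ← Real.rpow_mul (by positivity)]
  refine Real.rpow_le_rpow_of_exponent_le hp1'.le ?_
  have h := sub_one_mul_padicValNat_factorial (p := p) k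
  have h2 : (p - 1) * padicValNat p k.factorial ≤ k := h ▸ Nat.sub_le _ _
  have h3 : ((p : ℝ) - 1) * (padicValNat p k.factorial : ℝ) ≤ k := by
    have := (Nat.cast_le (α := ℝ)).2 h2
    rwa [Nat.cast_mul, Nat.cast_sub hp1.le, Nat.cast_one] at this
  rw [div_mul_eq_mul_div, one_mul, le_div_iff₀ (by linarith), mul_comm]
  exact h3

theorem binom_eq_eval (s : ℂ_[p]) (k : ℕ) :
    binom s k = ((k.factorial : ℂ_[p]))⁻¹ * (descPochhammer ℂ_[p] k).eval s := by
  rw [binom, descPochhammer_eval_eq_prod_range, div_eq_inv_mul]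

theorem norm_coeff_descPochhammer_le (k j : ℕ) : ‖(descPochhammer ℂ_[p] k).coeff j‖ ≤ 1 := by
  rw [← descPochhammer_map (Int.castRingHom ℂ_[p]) k, Polynomial.coeff_map]
  exact IsUltrametricDist.norm_intCast_le_one ℂ_[p] _

/-- Binomial series with coefficients `O(p ^ (-k))` are analytic in the disk of radius
`p ^ (1 - 1 / (p - 1))`. -/
theorem isPowerSeriesOn_binom (hp : p ≠ 2) (c : ℕ → ℂ_[p]) (hc : ∀ k, ‖c k‖ ≤ ((p : ℝ)⁻¹) ^ k) :
    (∀ s, ‖s‖ < radius p → Summable fun k => binom s k * c k) ∧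
      IsPowerSeriesOn (radius p) (fun s => ∑' k, binom s k * c k) := by
  have hp0 : (0 : ℝ) < p := by exact_mod_cast (Fact.out : p.Prime).pos
  have h := isPowerSeriesOn_tsum_mul_eval (one_lt_radius p hp)
    (fun k => c k * ((k.factorial : ℂ_[p]))⁻¹) (fun k => ?_) (descPochhammer ℂ_[p])
    (fun k => (descPochhammer_natDegree ℂ_[p] k).le) (norm_coeff_descPochhammer_le p)
  · have he : ∀ s k, c k * ((k.factorial : ℂ_[p]))⁻¹ * (descPochhammer ℂ_[p] k).eval s =
        binom s k * c k := fun s k => by rw [binom_eq_eval]; ring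
    simpa only [he] using h
  · have hr : (radius p)⁻¹ = (p : ℝ)⁻¹ * (p : ℝ) ^ (1 / ((p : ℝ) - 1)) := by
      rw [radius, Real.rpow_sub hp0, Real.rpow_one, inv_div, div_eq_inv_mul]
    rw [norm_mul, hr, mul_pow]
    exact mul_le_mul (hc k) (norm_inv_factorial_le p k) (norm_nonneg _) (by positivity)

theorem isUnit_natCast_zmod {a : ℕ} (ha : ¬ p ∣ a) : IsUnit (a : ZMod p) := by
  rw [isUnit_iff_ne_zero, Ne, ZMod.natCast_eq_zero_iff]
  exact ha

theorem norm_equiv_teichmuller {a : ℕ} (ha : ¬ p ∣ a) :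
    ‖(WittVector.equiv p (WittVector.teichmuller p (a : ZMod p)) : ℤ_[p])‖ = 1 := by
  rw [← PadicInt.isUnit_iff]
  exact ((isUnit_natCast_zmod p ha).map (WittVector.teichmuller p)).map (WittVector.equiv p)

theorem norm_sub_equiv_teichmuller_lt (a : ℕ) :
    ‖(a : ℤ_[p]) - WittVector.equiv p (WittVector.teichmuller p (a : ZMod p))‖ < 1 := by
  refine lt_of_le_of_ne (PadicInt.norm_le_one _) fun h => ?_
  -- Reduction mod $p$, read off as the zeroth Witt coordinate; it kills the difference, which
  -- therefore cannot be a unit.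
  let g : ℤ_[p] →+* ZMod p :=
    WittVector.constantCoeff.comp (WittVector.equiv p).symm.toRingHom
  have hu := (PadicInt.isUnit_iff.2 h).map g
  have hz : g ((a : ℤ_[p]) - WittVector.equiv p (WittVector.teichmuller p (a : ZMod p))) = 0 := by
    rw [map_sub, map_natCast, sub_eq_zero]
    change _ = WittVector.constantCoeff ((WittVector.equiv p).symm (WittVector.equiv p _))
    rw [RingEquiv.symm_apply_apply, WittVector.constantCoeff_apply,
      WittVector.teichmuller_coeff_zero]
  rw [hz] at hu
  exact not_isUnit_zero hu

theorem norm_teich {a : ℕ} (ha : ¬ p ∣ a) : ‖teich p (a : ZMod p)‖ = 1 := by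
  change ‖algebraMap ℚ_[p] ℂ_[p] ((WittVector.equiv p (WittVector.teichmuller p (a : ZMod p)) :
    ℤ_[p]) : ℚ_[p])‖ = 1
  rw [norm_algebraMap_padic]
  exact norm_equiv_teichmuller p ha

theorem norm_angle_sub_one_le {a : ℕ} (ha : ¬ p ∣ a) : ‖angle p a - 1‖ ≤ (p : ℝ)⁻¹ := by
  have h0 : teich p (a : ZMod p) ≠ 0 := norm_pos_iff.1 (by rw [norm_teich p ha]; exact one_pos)
  rw [angle, div_sub_one h0, norm_div, norm_teich p ha, div_one]
  change ‖(a : ℂ_[p]) - algebraMap ℚ_[p] ℂ_[p] ((WittVector.equiv p (WittVector.teichmuller p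
    (a : ZMod p)) : ℤ_[p]) : ℚ_[p])‖ ≤ _
  rw [← map_natCast (algebraMap ℚ_[p] ℂ_[p]), ← map_sub, norm_algebraMap_padic]
  have h := norm_sub_equiv_teichmuller_lt p a
  -- The norm on $\mathbb Z_p$ is discrete, so a norm below $1$ is at most $1/p$; the stated radius
  -- depends on this gain.
  have h2 := (PadicInt.norm_le_pow_iff_norm_lt_pow_add_one
    ((a : ℤ_[p]) - WittVector.equiv p (WittVector.teichmuller p (a : ZMod p))) (-1)).2
      (by simpa using h)
  rw [zpow_neg_one, PadicInt.norm_def] at h2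
  simpa using h2

theorem norm_natCast_of_not_dvd {a : ℕ} (ha : ¬ p ∣ a) : ‖(a : ℂ_[p])‖ = 1 := by
  rw [norm_natCast_padicComplex, Padic.norm_natCast_eq_one_iff]
  exact ((Fact.out : p.Prime).coprime_iff_not_dvd).2 ha

theorem norm_natCast_of_dvd {F : ℕ} (h : p ∣ F) : ‖(F : ℂ_[p])‖ ≤ (p : ℝ)⁻¹ := by
  obtain ⟨c, rfl⟩ := h
  rw [Nat.cast_mul, norm_mul, norm_prime_padicComplex]
  exact mul_le_of_le_one_right (by positivity) (IsUltrametricDist.norm_natCast_le_one ℂ_[p] c)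

variable {p}

theorem norm_sub_le_max_norm (x y : ℂ_[p]) : ‖x - y‖ ≤ max ‖x‖ ‖y‖ := by
  rw [sub_eq_add_neg, ← norm_neg y]
  exact IsUltrametricDist.norm_add_le_max x (-y)

theorem norm_le_one_of_norm_one_sub_lt {q : ℂ_[p]} (hq : ‖1 - q‖ < 1) : ‖q‖ ≤ 1 := by
  have := norm_sub_le_max_norm (1 : ℂ_[p]) (1 - q)
  rw [sub_sub_cancel, norm_one] at this
  exact this.trans (max_le le_rfl hq.le)

theorem norm_one_sub_pow_le {q : ℂ_[p]} (hq : ‖1 - q‖ < 1) (M : ℕ) :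
    ‖1 - q ^ M‖ ≤ ‖1 - q‖ := by
  rw [← mul_neg_geom_sum, norm_mul]
  refine mul_le_of_le_one_right (norm_nonneg _) ?_
  refine IsUltrametricDist.norm_sum_le_of_forall_le_of_nonneg zero_le_one fun i _ => ?_
  rw [norm_pow]
  exact pow_le_one₀ (norm_nonneg _) (norm_le_one_of_norm_one_sub_lt hq)

theorem norm_one_sub_pow_lt {q : ℂ_[p]} (hq : ‖1 - q‖ < 1) (M : ℕ) : ‖1 - q ^ M‖ < 1 :=
  (norm_one_sub_pow_le hq M).trans_lt hq

/-- $1+q$ is close to $2$, a unit for odd $p$. All denominators are nonzero for this reason. -/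
theorem norm_one_add (hp : p ≠ 2) {q : ℂ_[p]} (hq : ‖1 - q‖ < 1) : ‖1 + q‖ = 1 := by
  have h2 : ‖(2 : ℂ_[p])‖ = 1 := by
    have := norm_natCast_of_not_dvd p (a := 2)
      (fun h => hp ((Nat.prime_dvd_prime_iff_eq Fact.out Nat.prime_two).1 h))
    exact_mod_cast this
  have h : ‖-(1 - q)‖ < ‖(2 : ℂ_[p])‖ := by rwa [norm_neg, h2]
  rw [show (1 : ℂ_[p]) + q = 2 + -(1 - q) by ring,
    IsUltrametricDist.norm_add_eq_max_of_norm_ne_norm h.ne', max_eq_left h.le, h2]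

theorem one_sub_neg_pow_ne_zero (hp : p ≠ 2) {q : ℂ_[p]} (hq : ‖1 - q‖ < 1) {M : ℕ}
    (hM : Odd M) : 1 - (-q) ^ M ≠ 0 := by
  rw [hM.neg_pow, sub_neg_eq_add, ← norm_ne_zero_iff, norm_one_add hp (norm_one_sub_pow_lt hq M)]
  exact one_ne_zero

theorem qNumber_two {K : Type*} [Field K] (q : K) : qNumber q 2 = 1 + q := by
  simp [qNumber, Finset.sum_range_succ]

theorem qNumber_two_ne_zero (hp : p ≠ 2) {q : ℂ_[p]} (hq : ‖1 - q‖ < 1) : qNumber q 2 ≠ 0 := by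
  rw [qNumber_two, ← norm_ne_zero_iff, norm_one_add hp hq]
  exact one_ne_zero

/-- Compare coefficients after multiplying the generating function by $qe^t+1$. -/
theorem qEuler_recurrence {K : Type*} [Field K] [CharZero K] {q : K} (hq : 1 + q ≠ 0) (n : ℕ) :
    q * ∑ k ∈ Finset.range (n + 1), (n.choose k : K) * qEuler q k + qEuler q n =
      if n = 0 then 1 + q else 0 := by
  have hc : PowerSeries.constantCoeff (PowerSeries.C q * expSeries 1 + 1) ≠ 0 := by
    rw [← PowerSeries.coeff_zero_eq_constantCoeff_apply, map_add, PowerSeries.coeff_C_mul,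
      coeff_expSeries]
    simpa [add_comm] using hq
  set h := PowerSeries.C (qNumber q 2) * (PowerSeries.C q * expSeries 1 + 1)⁻¹ with hh
  have h1 : PowerSeries.C q * (h * expSeries 1) + h = PowerSeries.C (qNumber q 2) := by
    have h2 := PowerSeries.mul_inv_cancel _ hc
    rw [hh]
    linear_combination PowerSeries.C (qNumber q 2) * h2
  have h3 := congrArg (fun f => (n.factorial : K) * PowerSeries.coeff n f) h1
  simp only [map_add, PowerSeries.coeff_C_mul, mul_add] at h3
  simp only [PowerSeries.coeff_mul, Finset.Nat.sum_antidiagonal_eq_sum_range_succ_mk,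
    coeff_expSeries, one_pow] at h3
  have h4 : (n.factorial : K) * PowerSeries.coeff n (PowerSeries.C (qNumber q 2)) =
      if n = 0 then 1 + q else 0 := by
    rw [PowerSeries.coeff_C, qNumber_two]
    split_ifs with h0 <;> simp [h0]
  rw [← h4, ← h3, mul_left_comm]
  refine congrArg₂ (· + ·) (congrArg (q * ·) ((Finset.sum_congr rfl fun k hk => ?_).trans
    (Finset.mul_sum _ _ _).symm)) rfl
  have hk : k ≤ n := Nat.lt_succ_iff.1 (Finset.mem_range.1 hk)
  have hf : ((n - k).factorial : K) ≠ 0 := Nat.cast_ne_zero.2 (Nat.factorial_ne_zero _)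
  rw [← Nat.choose_mul_factorial_mul_factorial hk, qEuler, ← hh]
  push_cast
  field_simp

/-- The recurrence expresses $(1+q)E_n$ through earlier terms with integral coefficients, and $1+q$
has norm $1$. -/
theorem norm_qEuler_le (hp : p ≠ 2) {q : ℂ_[p]} (hq : ‖1 - q‖ < 1) (n : ℕ) :
    ‖qEuler q n‖ ≤ 1 := by
  have h1 := norm_one_add hp hq
  have h0 : 1 + q ≠ 0 := norm_ne_zero_iff.1 (by rw [h1]; exact one_ne_zero)
  have hq1 := norm_le_one_of_norm_one_sub_lt hq
  induction n using Nat.strong_induction_on with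
  | _ n ih =>
    have h := qEuler_recurrence h0 n
    rw [Finset.sum_range_succ, Nat.choose_self, Nat.cast_one, one_mul] at h
    have h' : (1 + q) * qEuler q n = (if n = 0 then 1 + q else 0) -
        q * ∑ k ∈ Finset.range n, (n.choose k : ℂ_[p]) * qEuler q k := by
      linear_combination h
    rw [← one_mul ‖qEuler q n‖, ← h1, ← norm_mul, h', h1]
    refine (norm_sub_le_max_norm _ _).trans (max_le ?_ ?_)
    · split_ifs <;> simp [h1]
    · rw [norm_mul]
      refine mul_le_one₀ hq1 (norm_nonneg _) ?_
      refine IsUltrametricDist.norm_sum_le_of_forall_le_of_nonneg zero_le_one fun k hk => ?_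
      rw [norm_mul]
      exact mul_le_one₀ (IsUltrametricDist.norm_natCast_le_one ℂ_[p] _) (norm_nonneg _)
        (ih k (Finset.mem_range.1 hk))

end Norms

/-! ### Values of the twisted characters -/

section Twist

theorem conductor_mul_dvd_lcm {R : Type*} [CommRing R] {d m : ℕ} (χ : DirichletCharacter R d)
    (ψ : DirichletCharacter R m) : (χ.mul ψ).conductor ∣ d.lcm m :=
  DirichletCharacter.conductor_dvd_level _

theorem primitive_mul_apply_of_coprime {R : Type*} [CommRing R] [IsDomain R] {d m : ℕ}
    [NeZero d] [NeZero m] {χ : DirichletCharacter R d} (hχ : χ.IsPrimitive)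
    (ψ : DirichletCharacter R m) {a : ℕ} (ha : a.Coprime m) :
    χ.primitive_mul ψ (a : ZMod (χ.mul ψ).conductor) = χ (a : ZMod d) * ψ (a : ZMod m) := by
  have : NeZero (d.lcm m) := ⟨Nat.lcm_ne_zero (NeZero.ne d) (NeZero.ne m)⟩
  by_cases had : a.Coprime d
  · have hL : IsCoprime (a : ℤ) ((d.lcm m : ℕ) : ℤ) :=
      Nat.isCoprime_iff_coprime.2 ((had.mul_right ha).coprime_dvd_right (Nat.lcm_dvd_mul d m))
    have h := DirichletCharacter.primitiveCharacter_apply_of_isCoprime (χ.mul ψ) hL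
    have h1 := DirichletCharacter.changeLevel_eq_cast_of_dvd' χ (Nat.dvd_lcm_left d m) hL
    have h2 := DirichletCharacter.changeLevel_eq_cast_of_dvd' ψ (Nat.dvd_lcm_right d m) hL
    have h3 : χ.mul ψ ((a : ℤ) : ZMod (d.lcm m)) =
        χ ((a : ℤ) : ZMod d) * ψ ((a : ℤ) : ZMod m) := by
      rw [DirichletCharacter.mul, MulChar.mul_apply, h1, h2]
    rw [h3] at h
    rw [DirichletCharacter.primitive_mul]
    simpa only [Int.cast_natCast] using h
  · have h0 : χ (a : ZMod d) = 0 := by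
      have := (DirichletCharacter.apply_eq_zero_iff χ (a : ℤ)).2
        (by rwa [Nat.isCoprime_iff_coprime])
      simpa only [Int.cast_natCast] using this
    have h1 : ¬ a.Coprime (χ.mul ψ).conductor := by
      intro hc
      refine had ((hc.mul_right ha).coprime_dvd_right ?_)
      -- Since $\chi=(\chi\psi)\psi^{-1}$ is primitive, $d$ divides the lcm of the conductors of
      -- $\chi\psi$ and $\psi$. Hence $a$ prime to $m$ and to the conductor of $\chi\psi$ would be
      -- prime to $d$.
      have h2 := DirichletCharacter.conductor_mul_dvd_lcm_conductor (χ.mul ψ)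
        (DirichletCharacter.changeLevel (Nat.dvd_lcm_right d m) ψ)⁻¹
      rw [DirichletCharacter.mul, mul_inv_cancel_right,
        DirichletCharacter.conductor_changeLevel, (show χ.conductor = d from hχ),
        DirichletCharacter.conductor_inv,
        DirichletCharacter.conductor_changeLevel] at h2
      refine h2.trans ((Nat.lcm_dvd_mul _ _).trans ?_)
      exact mul_dvd_mul_left _ (DirichletCharacter.conductor_dvd_level ψ)
    rw [h0, zero_mul]
    have := (DirichletCharacter.apply_eq_zero_iff (χ.primitive_mul ψ) (a : ℤ)).2
      (by rwa [Nat.isCoprime_iff_coprime])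
    simpa only [Int.cast_natCast] using this

variable {p : ℕ} [Fact p.Prime] {d : ℕ} [NeZero d]

theorem twist_apply {χ : DirichletCharacter ℂ_[p] d} (hχ : χ.IsPrimitive) (n : ℕ) {a : ℕ}
    (ha : ¬ p ∣ a) :
    twist χ n (a : ZMod _) = χ (a : ZMod d) * ((teich p (a : ZMod p))⁻¹) ^ n := by
  have hc : a.Coprime p := (((Fact.out : p.Prime).coprime_iff_not_dvd).2 ha).symm
  have h := primitive_mul_apply_of_coprime hχ ((teich p)⁻¹ ^ n) hc
  rw [twist, h, ← (isUnit_natCast_zmod p ha).unit_spec, MulChar.pow_apply_coe,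
    MulChar.inv_apply_eq_inv']

end Twist

/-! ### Values at negative integers -/

section Values

variable {p : ℕ} [Fact p.Prime]

theorem binom_natCast (n k : ℕ) : binom (n : ℂ_[p]) k = n.choose k := by
  rw [binom_eq_eval, descPochhammer_eval_eq_descFactorial,
    Nat.descFactorial_eq_factorial_mul_choose, Nat.cast_mul,
    inv_mul_cancel_left₀ (Nat.cast_ne_zero.2 k.factorial_ne_zero)]

theorem tsum_binom_natCast (n : ℕ) (c : ℕ → ℂ_[p]) :
    ∑' k, binom (n : ℂ_[p]) k * c k = ∑ k ∈ Finset.range (n + 1), (n.choose k : ℂ_[p]) * c k := by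
  simp only [binom_natCast]
  refine tsum_eq_sum fun k hk => ?_
  rw [Nat.choose_eq_zero_of_lt (by simpa using hk), Nat.cast_zero, zero_mul]

theorem padicPow_natCast (x : ℂ_[p]) (n : ℕ) : padicPow p x n = x ^ n := by
  rw [padicPow, tsum_binom_natCast]
  conv_rhs => rw [← sub_add_cancel x 1, add_pow]
  refine Finset.sum_congr rfl fun k _ => ?_
  rw [one_pow]
  ring

theorem lpq_neg_natCast (hp : p ≠ 2) {q : ℂ_[p]} (hq : ‖1 - q‖ < 1) {d : ℕ} [NeZero d]
    {χ : DirichletCharacter ℂ_[p] d} (hχ : χ.IsPrimitive) {F : ℕ} (hF : Odd F) (n : ℕ) :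
    lpq χ q F (-(n : ℂ_[p])) = qNumber q 2 * ((n.factorial : ℂ_[p]) * PowerSeries.coeff n
      (eulerQuot (fun a => if p ∣ a then 0 else twist χ n (a : ZMod _)) q F)) := by
  have hF0 := one_sub_neg_pow_ne_zero hp hq hF
  have hqF := qNumber_two_ne_zero hp (norm_one_sub_pow_lt hq F)
  rw [lpq, div_mul_eq_mul_div, mul_div_assoc, Finset.sum_filter, eulerQuot, expSum,
    Finset.sum_mul, map_sum, Finset.mul_sum, Finset.sum_div]
  congr 1
  refine Finset.sum_congr rfl fun a ha => ?_
  split_ifs with hpa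
  · simp
  · have ha0 : a ≠ 0 := fun h => hpa (h ▸ dvd_zero p)
    have h := sum_choose_mul_qEuler hF hF0 ha0 n
    simp only [neg_neg, mul_assoc (binom _ _), tsum_binom_natCast]
    simp only [← mul_assoc ((Nat.choose _ _ : ℕ) : ℂ_[p])]
    rw [padicPow_natCast, angle, twist_apply hχ n hpa, eulerBase_pow,
      mul_assoc (PowerSeries.C _), PowerSeries.coeff_C_mul, mul_assoc (PowerSeries.C _),
      PowerSeries.coeff_C_mul, div_eq_iff hqF, neg_pow, div_eq_mul_inv, mul_pow]
    linear_combination (-1) ^ a * χ (a : ZMod d) * q ^ a * (teich p (a : ZMod p))⁻¹ ^ n * h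

theorem odd_conductor_mul (hp : p ≠ 2) {d : ℕ} (hd : Odd d) (χ : DirichletCharacter ℂ_[p] d)
    (ψ : DirichletCharacter ℂ_[p] p) : Odd (χ.mul ψ).conductor :=
  (hd.mul ((Fact.out : p.Prime).odd_of_ne_two hp)).of_dvd_nat
    ((conductor_mul_dvd_lcm χ ψ).trans (Nat.lcm_dvd_mul d p))

/-- Removing the Euler factor at `p` from a generalized `q`-Euler number. -/
theorem qNumber_mul_coeff_eulerQuot (hp : p ≠ 2) {q : ℂ_[p]} (hq : ‖1 - q‖ < 1) {m : ℕ}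
    (hm : Odd m) (ψ : DirichletCharacter ℂ_[p] m) {F : ℕ} (hF : Odd F) (hpF : p ∣ F)
    (hmF : m ∣ F) (n : ℕ) :
    qNumber q 2 * ((n.factorial : ℂ_[p]) * PowerSeries.coeff n
      (eulerQuot (fun a => if p ∣ a then 0 else ψ (a : ZMod m)) q F)) =
    qEulerChar ψ q n - (p : ℂ_[p]) ^ n * ψ (p : ZMod m) *
      (qNumber q 2 / qNumber (q ^ p) 2) * qEulerChar ψ (q ^ p) n := by
  obtain ⟨F', rfl⟩ := hpF
  have hpo : Odd p := (Fact.out : p.Prime).odd_of_ne_two hp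
  have hF' : Odd F' := hF.of_dvd_nat (dvd_mul_left F' p)
  have hqp := norm_one_sub_pow_lt hq p
  have h1 := eulerQuot_mul_eq_add (fun a => ψ (a : ZMod m)) q hpo F'
    (one_sub_neg_pow_ne_zero hp hqp hF')
  have hper : ∀ a : ℕ, ψ ((a + m : ℕ) : ZMod m) = ψ (a : ZMod m) := fun a => by simp
  have h2 := eulerQuot_eq_of_dvd (g := fun a => ψ (a : ZMod m)) hper hmF
    (one_sub_neg_pow_ne_zero hp hq hm) (one_sub_neg_pow_ne_zero hp hq hF)
  -- $m$ divides $F'=F/p$ when $p\nmid m$. It may fail to when $p\mid m$, but then $\psi(p)=0$ and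
  -- both sides vanish.
  have h3 : PowerSeries.C (ψ (p : ZMod m)) * eulerQuot (fun b => ψ (b : ZMod m)) (q ^ p) F' =
      PowerSeries.C (ψ (p : ZMod m)) * eulerQuot (fun b => ψ (b : ZMod m)) (q ^ p) m := by
    by_cases hpm : p.Coprime m
    · rw [eulerQuot_eq_of_dvd (g := fun a => ψ (a : ZMod m)) hper
        (hpm.symm.dvd_of_dvd_mul_left hmF)
        (one_sub_neg_pow_ne_zero hp hqp hm) (one_sub_neg_pow_ne_zero hp hqp hF')]
    · have h0 := (DirichletCharacter.apply_eq_zero_iff ψ (p : ℤ)).2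
        (by rwa [Nat.isCoprime_iff_coprime])
      rw [Int.cast_natCast] at h0
      rw [h0, map_zero, zero_mul, zero_mul]
  have h4 : eulerQuot (fun b => ψ ((p * b : ℕ) : ZMod m)) (q ^ p) F' =
      PowerSeries.C (ψ (p : ZMod m)) * eulerQuot (fun b => ψ (b : ZMod m)) (q ^ p) F' := by
    simp only [Nat.cast_mul, map_mul]
    exact eulerQuot_const_mul _ _ _ _
  rw [h4, h3, h2] at h1
  have h5 := congrArg (PowerSeries.coeff n) h1
  rw [map_add, PowerSeries.coeff_rescale, PowerSeries.coeff_C_mul] at h5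
  have hqp0 := qNumber_two_ne_zero hp hqp
  rw [qEulerChar_eq hm, qEulerChar_eq hm, h5]
  field_simp
  ring

end Values

/-! ### The fermionic integral -/

section Integral

variable {p : ℕ} [Fact p.Prime]

/-- $1-y^p=(1-y)\bigl(p-\sum_{i<p}(1-y^i)\bigr)$, so each $p$-th power shrinks the distance to $1$
by the factor $\rho=\max(|1-x|,1/p)<1$. -/
theorem tendsto_pow_prime_pow {x : ℂ_[p]} (hx : ‖1 - x‖ < 1) :
    Tendsto (fun N : ℕ => x ^ p ^ N) atTop (𝓝 1) := by
  set ρ : ℝ := max ‖1 - x‖ (p : ℝ)⁻¹ with hρ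
  have hρ0 : 0 ≤ ρ := (norm_nonneg _).trans (le_max_left _ _)
  have hρ1 : ρ < 1 :=
    max_lt hx (inv_lt_one_of_one_lt₀ (by exact_mod_cast (Fact.out : p.Prime).one_lt))
  have hstep : ∀ {y : ℂ_[p]}, ‖1 - y‖ ≤ ‖1 - x‖ → ‖1 - y ^ p‖ ≤ ρ * ‖1 - y‖ := by
    intro y hy
    have h : ∑ i ∈ Finset.range p, y ^ i = p - ∑ i ∈ Finset.range p, (1 - y ^ i) := by
      simp
    rw [← mul_neg_geom_sum, norm_mul, mul_comm ρ]
    refine mul_le_mul_of_nonneg_left ?_ (norm_nonneg _)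
    rw [h]
    refine (norm_sub_le_max_norm _ _).trans (max_le ?_ ?_)
    · rw [norm_prime_padicComplex]
      exact le_max_right _ _
    · refine IsUltrametricDist.norm_sum_le_of_forall_le_of_nonneg hρ0 fun i _ => ?_
      exact ((norm_one_sub_pow_le (hy.trans_lt hx) i).trans hy).trans (le_max_left _ _)
  have hN : ∀ N : ℕ, ‖1 - x ^ p ^ N‖ ≤ ρ ^ N * ‖1 - x‖ := by
    intro N
    induction N with
    | zero => simp
    | succ N ih =>
      rw [pow_succ p, pow_mul, pow_succ' ρ, mul_assoc]
      refine (hstep (norm_one_sub_pow_le hx _)).trans ?_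
      gcongr
  rw [tendsto_iff_norm_sub_tendsto_zero]
  refine squeeze_zero (fun _ => norm_nonneg _) (fun N => (norm_sub_rev _ _).trans_le (hN N)) ?_
  simpa using (tendsto_pow_atTop_nhds_zero_of_lt_one hρ0 hρ1).mul_const ‖1 - x‖

theorem tendsto_natCast_mul_prime_pow (d : ℕ) :
    Tendsto (fun N : ℕ => ((d * p ^ N : ℕ) : ℂ_[p])) atTop (𝓝 0) := by
  have h : ‖(p : ℂ_[p])‖ < 1 := by
    rw [norm_prime_padicComplex]
    exact inv_lt_one_of_one_lt₀ (by exact_mod_cast (Fact.out : p.Prime).one_lt)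
  simpa using (tendsto_pow_atTop_nhds_zero_of_norm_lt_one h).const_mul (d : ℂ_[p])

/-- $B^{dp^N}=-q^{dp^N}e^{dp^Nt}$, where $q^{dp^N}\to1$ and $dp^N\to0$ $p$-adically. -/
theorem tendsto_coeff_mul_one_sub_eulerBase_pow (hp : p ≠ 2) {q : ℂ_[p]} (hq : ‖1 - q‖ < 1)
    {d : ℕ} (hd : Odd d) (f : PowerSeries ℂ_[p]) (n : ℕ) :
    Tendsto (fun N : ℕ => PowerSeries.coeff n (f * (1 - eulerBase q ^ (d * p ^ N)))) atTop
      (𝓝 (PowerSeries.coeff n f * 2)) := by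
  have hpo : Odd p := (Fact.out : p.Prime).odd_of_ne_two hp
  have h1 : ∀ j, Tendsto (fun N : ℕ => PowerSeries.coeff j (1 - eulerBase q ^ (d * p ^ N))) atTop
      (𝓝 (PowerSeries.coeff j (PowerSeries.C (2 : ℂ_[p])))) := by
    intro j
    have he : ∀ N : ℕ, PowerSeries.coeff j (1 - eulerBase q ^ (d * p ^ N)) =
        PowerSeries.coeff j 1 + (q ^ d) ^ p ^ N *
          (((d * p ^ N : ℕ) : ℂ_[p]) ^ j / j.factorial) := by
      intro N
      rw [map_sub, coeff_eulerBase_pow, (hd.mul hpo.pow).neg_pow, pow_mul]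
      ring
    simp only [he]
    have h2 := (tendsto_pow_prime_pow (norm_one_sub_pow_lt hq d)).mul
      (((tendsto_natCast_mul_prime_pow (p := p) d).pow j).div_const (j.factorial : ℂ_[p]))
    have h3 := h2.const_add (PowerSeries.coeff j (1 : PowerSeries ℂ_[p]))
    convert h3 using 2
    rw [PowerSeries.coeff_C, PowerSeries.coeff_one]
    split_ifs with hj
    · simp [hj, one_add_one_eq_two]
    · simp [hj]
  have h2 : PowerSeries.coeff n f * 2 = PowerSeries.coeff n (f * PowerSeries.C (2 : ℂ_[p])) := by
    rw [PowerSeries.coeff_mul_C]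
  rw [h2]
  simp only [PowerSeries.coeff_mul]
  exact tendsto_finsetSum _ fun x _ => (h1 x.2).const_mul _

theorem natCast_mem_Xstar {d : ℕ} [NeZero d] (x : ℕ) : (x : X p d) ∈ Xstar p d ↔ ¬ p ∣ x := by
  have hpp : p.Prime := Fact.out
  have hpos : 0 < d * p := Nat.mul_pos (NeZero.pos d) hpp.pos
  simp only [Xstar, Set.mem_ofPred_eq, map_natCast, ZMod.natCast_eq_natCast_iff, pow_one]
  constructor
  · rintro ⟨a, -, -, hap, hxa⟩ hx
    have h : p ∣ a := ((hxa.of_dvd (dvd_mul_left p d)).dvd_iff dvd_rfl).1 hx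
    exact hpp.coprime_iff_not_dvd.1 hap.symm h
  · intro hx
    have h : ¬ p ∣ x % (d * p) := by
      rwa [Nat.dvd_mod_iff (dvd_mul_left p d)]
    refine ⟨x % (d * p), Nat.pos_of_ne_zero fun h0 => h (h0 ▸ dvd_zero p), Nat.mod_lt _ hpos,
      (hpp.coprime_iff_not_dvd.2 h).symm, (Nat.mod_modEq x (d * p)).symm⟩

theorem charMonomial_natCast {d m : ℕ} (hm : m ∣ d * p) (ψ : DirichletCharacter ℂ_[p] m)
    (n x : ℕ) : charMonomial ψ n (x : X p d) = ψ (x : ZMod m) * (x : ℂ_[p]) ^ n := by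
  rw [charMonomial, map_natCast, map_natCast, PadicInt.coe_natCast, map_natCast,
    ZMod.cast_natCast (by rwa [pow_one])]

theorem hasFermionicIntegralOn_Xstar_charMonomial (hp : p ≠ 2) {q : ℂ_[p]} (hq : ‖1 - q‖ < 1)
    {d : ℕ} (hd : Odd d) {m : ℕ} (hm : m ∣ d.lcm p) (ψ : DirichletCharacter ℂ_[p] m) {F : ℕ}
    (hF : Odd F) (hpF : p ∣ F) (hdF : d ∣ F) (n : ℕ) :
    HasFermionicIntegralOn q (Xstar p d) (charMonomial ψ n)
      (qNumber q 2 * ((n.factorial : ℂ_[p]) * PowerSeries.coeff n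
        (eulerQuot (fun a => if p ∣ a then 0 else ψ (a : ZMod m)) q F))) := by
  have : NeZero d := ⟨hd.pos.ne'⟩
  have hpo : Odd p := (Fact.out : p.Prime).odd_of_ne_two hp
  set g : ℕ → ℂ_[p] := fun a => if p ∣ a then 0 else ψ (a : ZMod m) with hg
  -- $F$ and $dp^N$ need not divide one another; $\operatorname{lcm}(d,p)$ is a period of $g$
  -- dividing both once $N\ge1$.
  have hper : ∀ a, g (a + d.lcm p) = g a := by
    intro a
    have h0 : ((d.lcm p : ℕ) : ZMod m) = 0 := (ZMod.natCast_eq_zero_iff _ _).2 hm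
    simp only [hg, Nat.cast_add, h0, add_zero, (Nat.dvd_add_left (Nat.dvd_lcm_right d p))]
  have hlcm : Odd (d.lcm p) := (hd.mul hpo).of_dvd_nat (Nat.lcm_dvd_mul d p)
  have hodd : ∀ N, Odd (d * p ^ N) := fun N => hd.mul hpo.pow
  have hne : ∀ {M : ℕ}, Odd M → 1 - (-q) ^ M ≠ 0 := one_sub_neg_pow_ne_zero hp hq
  have hFl := eulerQuot_eq_of_dvd hper (Nat.lcm_dvd hdF hpF) (hne hlcm) (hne hF)
  have hq0 : 1 + q ≠ 0 := by
    rw [← qNumber_two]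
    exact qNumber_two_ne_zero hp hq
  have hsum : ∀ N, 1 ≤ N → (1 / qNumber (-q) (d * p ^ N)) *
      ∑ x ∈ Finset.range (d * p ^ N),
        (Xstar p d).indicator (charMonomial ψ n) (x : X p d) * (-q) ^ x =
      (1 + q) / (1 + (q ^ d) ^ p ^ N) * ((n.factorial : ℂ_[p]) * PowerSeries.coeff n
        (eulerQuot g q F * (1 - eulerBase q ^ (d * p ^ N)))) := by
    intro N hN
    have hpN : p ∣ d * p ^ N := (dvd_pow_self p (by omega)).mul_left d
    have hlN : d.lcm p ∣ d * p ^ N := Nat.lcm_dvd (dvd_mul_right _ _) hpN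
    have hterm : ∀ x : ℕ, (Xstar p d).indicator (charMonomial ψ n) (x : X p d) * (-q) ^ x =
        g x * (x : ℂ_[p]) ^ n * (-q) ^ x := by
      intro x
      by_cases hx : p ∣ x
      · rw [Set.indicator_of_notMem (by rw [natCast_mem_Xstar]; exact not_not.2 hx)]
        simp [hg, hx]
      · rw [Set.indicator_of_mem ((natCast_mem_Xstar x).2 hx),
          charMonomial_natCast (hm.trans (Nat.lcm_dvd_mul d p))]
        simp [hg, hx]
    have hq1 : -q ≠ 1 := fun h => hq0 (by rw [← h]; ring)
    rw [hFl, ← eulerQuot_eq_of_dvd hper hlN (hne hlcm) (hne (hodd N)),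
      ← expSum_eq_eulerQuot_mul g (hne (hodd N)), factorial_mul_coeff_expSum,
      qNumber_eq_div hq1, one_div_div, (hodd N).neg_pow, pow_mul, sub_neg_eq_add, sub_neg_eq_add,
      Finset.sum_congr rfl fun x _ => hterm x, sum_Icc_one_eq_sum_range]
    congr 1
    -- The integral sums over $0\le x<dp^N$, the generating series over $1\le a\le dp^N$. Both end
    -- terms vanish because $p$ divides $0$ and $dp^N$.
    have h := Finset.sum_range_succ (fun x : ℕ => g x * (x : ℂ_[p]) ^ n * (-q) ^ x) (d * p ^ N)
    rw [Finset.sum_range_succ'] at h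
    have hg0 : g 0 = 0 := by simp [hg]
    have hgN : g (d * p ^ N) = 0 := by simp only [hg, hpN, if_true]
    rw [hg0, hgN] at h
    simpa only [zero_mul, add_zero] using h.symm
  have h2 : (1 + 1 : ℂ_[p]) ≠ 0 := by norm_num
  have hlim : Tendsto (fun N : ℕ => (1 + q) / (1 + (q ^ d) ^ p ^ N)) atTop
      (𝓝 ((1 + q) / (1 + 1))) :=
    tendsto_const_nhds.div ((tendsto_pow_prime_pow (norm_one_sub_pow_lt hq d)).const_add 1) h2
  have h := hlim.mul
    ((tendsto_coeff_mul_one_sub_eulerBase_pow hp hq hd (eulerQuot g q F) n).const_mul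
      (n.factorial : ℂ_[p]))
  have he : (1 + q) / (1 + 1) * ((n.factorial : ℂ_[p]) *
      (PowerSeries.coeff n (eulerQuot g q F) * 2)) = qNumber q 2 * ((n.factorial : ℂ_[p]) *
        PowerSeries.coeff n (eulerQuot g q F)) := by
    rw [qNumber_two]
    ring
  rw [he] at h
  refine h.congr' ?_
  filter_upwards [eventually_ge_atTop 1] with N hN
  exact (hsum N hN).symm

end Integral

/-! ### Analyticity -/

section Analytic

variable {p : ℕ} [Fact p.Prime]

theorem norm_angle_sub_one_pow_le {a : ℕ} (ha : ¬ p ∣ a) (k : ℕ) :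
    ‖(angle p a - 1) ^ k‖ ≤ ((p : ℝ)⁻¹) ^ k := by
  rw [norm_pow]
  exact pow_le_pow_left₀ (norm_nonneg _) (norm_angle_sub_one_le p ha) k

theorem norm_div_pow_mul_qEuler_le (hp : p ≠ 2) {q : ℂ_[p]} (hq : ‖1 - q‖ < 1) {F : ℕ}
    (hpF : p ∣ F) {a : ℕ} (ha : ¬ p ∣ a) (k : ℕ) :
    ‖((F : ℂ_[p]) / (a : ℂ_[p])) ^ k * qEuler (q ^ F) k‖ ≤ ((p : ℝ)⁻¹) ^ k := by
  rw [norm_mul, norm_pow, norm_div, norm_natCast_of_not_dvd p ha, div_one]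
  refine (mul_le_of_le_one_right (by positivity)
    (norm_qEuler_le hp (norm_one_sub_pow_lt hq F) k)).trans ?_
  exact pow_le_pow_left₀ (norm_nonneg _) (norm_natCast_of_dvd p hpF) k

theorem isPowerSeriesOn_lpq (hp : p ≠ 2) {q : ℂ_[p]} (hq : ‖1 - q‖ < 1) {d : ℕ}
    (χ : DirichletCharacter ℂ_[p] d) {F : ℕ} (hpF : p ∣ F) :
    IsPowerSeriesOn (radius p) (lpq χ q F) := by
  refine (isPowerSeriesOn_const _ _).mul (IsPowerSeriesOn.sum _ fun a ha => ?_)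
  have hpa : ¬ p ∣ a := (Finset.mem_filter.1 ha).2
  have h1 := (isPowerSeriesOn_binom p hp _ (norm_angle_sub_one_pow_le hpa)).2.comp_neg
  have h2 := (isPowerSeriesOn_binom p hp _ (norm_div_pow_mul_qEuler_le hp hq hpF hpa)).2.comp_neg
  simp only [← mul_assoc] at h2
  exact ((isPowerSeriesOn_const _ _).mul h1).mul h2

end Analytic

end QEuler

end

theorem theorem7 (p : ℕ) [Fact p.Prime] (hp : p ≠ 2)
    (q : ℂ_[p]) (hq : ‖1 - q‖ < 1)
    (d : ℕ) (χ : DirichletCharacter ℂ_[p] d) (hχ : χ.IsPrimitive)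
    (F : ℕ) (hF : Odd F) (hpF : p ∣ F) (hdF : d ∣ F) :
    -- all the series in the definition of `l_{p,q}(s, χ)` converge in the disk
    ((∀ s : ℂ_[p], ‖s‖ < QEuler.radius p → ∀ a ∈ Finset.Icc 1 F, ¬ p ∣ a →
        Summable (fun k : ℕ => QEuler.binom (-s) k * (QEuler.angle p a - 1) ^ k) ∧
        Summable (fun k : ℕ => QEuler.binom (-s) k * ((F : ℂ_[p]) / (a : ℂ_[p])) ^ k *
          QEuler.qEuler (q ^ F) k)) ∧
    -- (a): the function is given by one power series on the whole disk
      ∃ P : FormalMultilinearSeries ℂ_[p] ℂ_[p] ℂ_[p],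
        HasFPowerSeriesOnBall (QEuler.lpq χ q F) P 0 (ENNReal.ofReal (QEuler.radius p))) ∧
    -- (b)
    (∀ n : ℕ, 0 < n →
      QEuler.lpq χ q F (-(n : ℂ_[p])) =
        QEuler.qEulerChar (QEuler.twist χ n) q n -
          (p : ℂ_[p]) ^ n * QEuler.twist χ n (p : ZMod _) *
            (QEuler.qNumber q 2 / QEuler.qNumber (q ^ p) 2) *
            QEuler.qEulerChar (QEuler.twist χ n) (q ^ p) n) ∧
    -- (c)
    (∀ n : ℕ, 0 < n →
      QEuler.HasFermionicIntegralOn q (QEuler.Xstar p d)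
        (QEuler.charMonomial (QEuler.twist χ n) n) (QEuler.lpq χ q F (-(n : ℂ_[p])))) := by
  have hd : Odd d := hF.of_dvd_nat hdF
  have : NeZero d := ⟨hd.pos.ne'⟩
  have hval := fun n => QEuler.lpq_neg_natCast hp hq hχ hF n
  have hcond := fun n => QEuler.conductor_mul_dvd_lcm χ ((QEuler.teich p)⁻¹ ^ n)
  refine ⟨⟨fun s hs a _ hpa => ?_, ?_⟩, fun n _ => ?_, fun n _ => ?_⟩
  · have hs' : ‖-s‖ < QEuler.radius p := by rwa [norm_neg]
    refine ⟨(QEuler.isPowerSeriesOn_binom p hp _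
      (QEuler.norm_angle_sub_one_pow_le hpa)).1 _ hs', ?_⟩
    simp only [mul_assoc]
    exact (QEuler.isPowerSeriesOn_binom p hp _
      (QEuler.norm_div_pow_mul_qEuler_le hp hq hpF hpa)).1 _ hs'
  · exact (QEuler.isPowerSeriesOn_lpq hp hq χ hpF).hasFPowerSeriesOnBall
      (one_pos.trans (QEuler.one_lt_radius p hp))
  · rw [hval]
    exact QEuler.qNumber_mul_coeff_eulerQuot hp hq (QEuler.odd_conductor_mul hp hd χ _)
      (QEuler.twist χ n) hF hpF ((hcond n).trans (Nat.lcm_dvd hdF hpF)) n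
  · rw [hval]
    exact QEuler.hasFermionicIntegralOn_Xstar_charMonomial hp hq hd (hcond n)
      (QEuler.twist χ n) hF hpF hdF n
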